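/- Let $k$ be a number field and let $(\mathcal E,\rho,\sigma)$ be an isotrivial rational elliptic surface with base $\mathbb P^1_k$: $\mathcal E$ is a smooth proper geometrically integral surface over $k$, $\rho:\mathcal E\to\mathbb P^1_k$ is a relatively minimal elliptic fibration with section $\sigma$ and with at least one geometrically singular fibre, $\mathcal E_{\bar k}$ is birational to $\mathbb P^2_{\bar k}$, and the $j$-invariant of the generic fibre $E/k(T)$ lies in $k$. Let $$Y^2=X^3+a(T)X+b(T),\qquad a,b\in k[T],\quad \deg a\le 4,\ \deg b\le 6,\ 4a^3+27b^2\notin k,$$ be a Weierstrass equation of $E$ (with origin given by $\sigma$), and let $X$ be the associated sextic hypersurface $$w^2=z^3+y^4a(x/y)\,z+y^6b(x/y)$$ in $\mathbb P_k(1,1,2,3)=\operatorname{Proj}k[x,y,z,w]$. Suppose that $X$ is smooth over $k$. Then there is a squarefree homogeneous form $F(x,y)\in k[x,y]$ of degree $6$ such that $X$ is isomorphic over $k$ to the hypersurface $$w^2=z^3+F(x,y)$$ in $\mathbb P_k(1,1,2,3)$. Moreover $F$ can be chosen such that $E$ (with origin given by $\sigma$) has the Weierstrass equation $Y^2=X^3+f(T)$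 with $f(T)=F(T,1)$; here $f$ is squarefree, is not a square in $k[T]$, and $1\le\deg f\le 6$, so $\mathcal E$ is a family of sextic twists. -/

import Mathlib

open CategoryTheory CategoryTheory.Limits AlgebraicGeometry

universe u

noncomputable section

namespace RatEllSurf

attribute [local instance] MvPolynomial.weightedGradedAlgebra

/-! ### Projective spectra of graded algebras over a field -/

/-- The structure morphism `Proj A ⟶ Spec K` of a graded `K`-algebra `A`. -/
def projStr {K A : Type u} [Field K] [CommRing A] [Algebra K A] (𝒜 : ℕ → Submodule K A)
    [GradedAlgebra 𝒜] : Proj 𝒜 ⟶ Spec (.of K) :=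
  Proj.toSpecZero 𝒜 ≫ Spec.map (CommRingCat.ofHom (algebraMap K (𝒜 0)))

/-- The weighted projective space with weights `w` over `K`. -/
abbrev WPSpace (K : Type u) [Field K] {n : ℕ} (w : Fin n → ℕ) : Scheme.{u} :=
  Proj (MvPolynomial.weightedHomogeneousSubmodule K w)

/-- Projective `n`-space over `K`. -/
abbrev PSpace (K : Type u) [Field K] (n : ℕ) : Scheme.{u} :=
  WPSpace K (fun _ : Fin (n + 1) => 1)

/-- The structure morphism of projective `n`-space over `K`. -/
abbrev PSpace.str (K : Type u) [Field K] (n : ℕ) : PSpace K n ⟶ Spec (.of K) :=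
  projStr (MvPolynomial.weightedHomogeneousSubmodule K (fun _ : Fin (n + 1) => 1))

/-! ### Hypersurfaces in weighted projective spaces -/

/-- Weighted homogeneous polynomials of degree `d`, for the weights `w` of the variables. -/
structure WForm (K : Type u) [Field K] {n : ℕ} (w : Fin n → ℕ) (d : ℕ) where
  poly : MvPolynomial (Fin n) K
  homog : MvPolynomial.IsWeightedHomogeneous w poly d

namespace WForm

variable {K : Type u} [Field K] {n : ℕ} {w : Fin n → ℕ} {d : ℕ} (f : WForm K w d)

/-- The homogeneous coordinate ring of the hypersurface `f = 0`. -/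
abbrev CoordRing : Type u := MvPolynomial (Fin n) K ⧸ Ideal.span {f.poly}

/-- The grading of the homogeneous coordinate ring: the degree `i` part is the image of the
weighted homogeneous polynomials of degree `i`. -/
def grading (i : ℕ) : Submodule K f.CoordRing :=
  (MvPolynomial.weightedHomogeneousSubmodule K w i).map
    (Ideal.Quotient.mkₐ K (Ideal.span {f.poly})).toLinearMap

lemma mk_mem_grading {i : ℕ} {p : MvPolynomial (Fin n) K}
    (hp : p ∈ MvPolynomial.weightedHomogeneousSubmodule K w i) :
    Ideal.Quotient.mkₐ K (Ideal.span {f.poly}) p ∈ f.grading i :=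
  ⟨p, hp, rfl⟩

instance : SetLike.GradedMonoid f.grading where
  one_mem := f.mk_mem_grading (MvPolynomial.isWeightedHomogeneous_one K w)
  mul_mem := by
    rintro i j _ _ ⟨p, hp, rfl⟩ ⟨q, hq, rfl⟩
    exact f.mk_mem_grading (MvPolynomial.IsWeightedHomogeneous.mul hp hq)

/-- Reduction modulo `f` in degree `i`. -/
def gradedMk (i : ℕ) : MvPolynomial.weightedHomogeneousSubmodule K w i →ₗ[K] f.grading i :=
  ((Ideal.Quotient.mkₐ K (Ideal.span {f.poly})).toLinearMap.comp
    (MvPolynomial.weightedHomogeneousSubmodule K w i).subtype).codRestrict (f.grading i)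
    fun p => f.mk_mem_grading p.2

/-- Reduction modulo `f`, on the direct sum of the graded parts. -/
def sumMk : DirectSum ℕ (fun i => MvPolynomial.weightedHomogeneousSubmodule K w i) →ₐ[K]
    DirectSum ℕ (fun i => f.grading i) :=
  DirectSum.toAlgebra K (fun i => MvPolynomial.weightedHomogeneousSubmodule K w i)
    (fun i => (DirectSum.lof K ℕ (fun i => f.grading i) i).comp (f.gradedMk i))
    (by rfl)
    (fun {i j} x y => by
      simp only [LinearMap.comp_apply, DirectSum.lof_eq_of, DirectSum.of_mul_of]
      rfl)

lemma sumMk_of (i : ℕ) (x : MvPolynomial.weightedHomogeneousSubmodule K w i) :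
    f.sumMk (DirectSum.of (fun i => MvPolynomial.weightedHomogeneousSubmodule K w i) i x) =
      DirectSum.of (fun i => f.grading i) i (f.gradedMk i x) :=
  DirectSum.toAddMonoid_of _ _ _

/-- The decomposition of a polynomial into the classes of its homogeneous components. -/
def preDecompose : MvPolynomial (Fin n) K →ₐ[K] DirectSum ℕ (fun i => f.grading i) :=
  f.sumMk.comp
    (DirectSum.decomposeAlgEquiv (MvPolynomial.weightedHomogeneousSubmodule K w)).toAlgHom

lemma preDecompose_of_mem {i : ℕ} (p : MvPolynomial (Fin n) K)
    (hp : p ∈ MvPolynomial.weightedHomogeneousSubmodule K w i) :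
    f.preDecompose p = DirectSum.of (fun i => f.grading i) i ⟨_, f.mk_mem_grading hp⟩ := by
  have h : DirectSum.decompose (MvPolynomial.weightedHomogeneousSubmodule K w) p
      = DirectSum.of (fun i => MvPolynomial.weightedHomogeneousSubmodule K w i) i ⟨p, hp⟩ :=
    DirectSum.decompose_of_mem _ hp
  exact (congrArg f.sumMk h).trans (f.sumMk_of i ⟨p, hp⟩)

/-- The decomposition of the homogeneous coordinate ring into its graded parts. -/
def decomp : f.CoordRing →ₐ[K] DirectSum ℕ (fun i => f.grading i) :=
  Ideal.Quotient.liftₐ _ f.preDecompose <| by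
    intro a ha
    obtain ⟨b, rfl⟩ := Ideal.mem_span_singleton.mp ha
    have h0 : f.preDecompose f.poly = 0 := by
      rw [f.preDecompose_of_mem f.poly f.homog]
      convert map_zero (DirectSum.of (fun i => f.grading i) d)
      exact Ideal.Quotient.eq_zero_iff_mem.mpr (Ideal.mem_span_singleton_self _)
    rw [map_mul, h0, zero_mul]

instance : GradedAlgebra f.grading :=
  GradedAlgebra.ofAlgHom f.grading f.decomp
    (by
      refine Ideal.Quotient.algHom_ext _ (MvPolynomial.algHom_ext fun j => ?_)
      change DirectSum.coeAlgHom f.grading (f.preDecompose (MvPolynomial.X j)) = _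
      rw [f.preDecompose_of_mem _ (MvPolynomial.isWeightedHomogeneous_X K w j),
        DirectSum.coeAlgHom_of]
      rfl)
    (by
      rintro i ⟨_, p, hp, rfl⟩
      exact f.preDecompose_of_mem p hp)

/-- The hypersurface `f = 0` in the weighted projective space with weights `w`. -/
abbrev hypersurface : Scheme.{u} := Proj f.grading

/-- The structure morphism of the hypersurface `f = 0`. -/
abbrev str : f.hypersurface ⟶ Spec (.of K) := projStr f.grading

end WForm

/-- The plane projective cubic given by a Weierstrass equation. -/
def weierstrassForm {K : Type u} [Field K] (W : WeierstrassCurve K) :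
    WForm K (fun _ : Fin 3 => 1) 3 where
  poly := W.toProjective.polynomial
  homog := by
    have hX : ∀ (j : Fin 3) (m : ℕ), MvPolynomial.IsHomogeneous
        (MvPolynomial.X j ^ m : MvPolynomial (Fin 3) K) m := MvPolynomial.isHomogeneous_X_pow
    have hx : ∀ j : Fin 3, MvPolynomial.IsHomogeneous
        (MvPolynomial.X j : MvPolynomial (Fin 3) K) 1 := MvPolynomial.isHomogeneous_X K
    have hC : ∀ c : K, MvPolynomial.IsHomogeneous
        (MvPolynomial.C c : MvPolynomial (Fin 3) K) 0 := MvPolynomial.isHomogeneous_C _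
    change MvPolynomial.IsHomogeneous _ 3
    rw [WeierstrassCurve.Projective.polynomial]
    refine ((((hX 1 2).mul (hx 2)).add ((((hC _).mul (hx 0)).mul (hx 1)).mul (hx 2))).add
      (((hC _).mul (hx 1)).mul (hX 2 2))).sub ((((hX 0 3).add
      (((hC _).mul (hX 0 2)).mul (hx 2))).add (((hC _).mul (hx 0)).mul (hX 2 2))).add
      ((hC _).mul (hX 2 3)))

/-! ### Elliptic surfaces over the projective line -/

section

variable (k : Type u) [Field k]

/-- The homomorphism `K[x, y]_{(y)} → K(T)` (degree `0` part of the localization at `y`) that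
sends `x / y` to `T`. -/
def awayToRatFunc :
    HomogeneousLocalization.Away
      (MvPolynomial.weightedHomogeneousSubmodule k (fun _ : Fin (1 + 1) => 1))
      (MvPolynomial.X 1) →+* RatFunc k :=
  (IsLocalization.Away.lift (S := Localization.Away (MvPolynomial.X 1 : MvPolynomial (Fin 2) k))
    (MvPolynomial.X 1 : MvPolynomial (Fin 2) k)
    (g := (MvPolynomial.aeval ![(RatFunc.X : RatFunc k), 1]).toRingHom)
    (by simp)).comp
  (algebraMap _ _)

/-- The generic point `[T : 1]` of the projective line, as a morphism `Spec k(T) ⟶ ℙ¹`. -/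
def genericPt : Spec (.of (RatFunc k)) ⟶ PSpace k 1 :=
  Spec.map (CommRingCat.ofHom (awayToRatFunc k)) ≫
    Proj.awayι (MvPolynomial.weightedHomogeneousSubmodule k (fun _ : Fin (1 + 1) => 1))
      (MvPolynomial.X 1) (MvPolynomial.isWeightedHomogeneous_X k _ 1) one_pos

variable {k}

/-- Given a morphism `ρ : S ⟶ ℙ¹` with a section `σ`, the Weierstrass curve `W` over `k(T)` is a
Weierstrass equation of the generic fibre of `ρ`: there is an isomorphism over `k(T)` between the
generic fibre and the plane cubic `W`, which takes the point of the generic fibre given by `σ` to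
the point at infinity (the unique point of the cubic on the line `Z = 0`). -/
def IsGenericFibre {S : Scheme.{u}} (ρ : S ⟶ PSpace k 1) (σ : PSpace k 1 ⟶ S)
    (hσ : σ ≫ ρ = 𝟙 _) (W : WeierstrassCurve (RatFunc k)) : Prop :=
  ∃ e : pullback ρ (genericPt k) ≅ (weierstrassForm W).hypersurface,
    e.hom ≫ (weierstrassForm W).str = pullback.snd ρ (genericPt k) ∧
    ∀ t, Ideal.Quotient.mk _ (MvPolynomial.X 2) ∈
      (((pullback.lift (genericPt k ≫ σ) (𝟙 _) (by simp [hσ]) :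
        Spec (.of (RatFunc k)) ⟶ pullback ρ (genericPt k)) ≫ e.hom) t).asHomogeneousIdeal

/-- `f : S ⟶ S'` is birational: it is an isomorphism above a dense open subset of `S'`
whose preimage is dense. -/
def IsBirationalMorphism {S S' : Scheme.{u}} (f : S ⟶ S') : Prop :=
  ∃ U : S'.Opens, Dense (U : Set S') ∧ Dense ((f ⁻¹ᵁ U : S.Opens) : Set S) ∧ IsIso (f ∣_ U)

variable (k) in
/-- Elliptic surfaces with base the projective line over `k`. -/
structure EllipticSurface where
  /-- the total space -/
  S : Scheme.{u}
  /-- the fibration -/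
  ρ : S ⟶ PSpace k 1
  /-- the section -/
  σ : PSpace k 1 ⟶ S
  section_eq : σ ≫ ρ = 𝟙 _
  /-- the total space is a smooth, proper, geometrically integral surface over `k` -/
  smooth : SmoothOfRelativeDimension 2 (ρ ≫ PSpace.str k 1)
  proper : IsProper (ρ ≫ PSpace.str k 1)
  integral : GeometricallyIntegral (ρ ≫ PSpace.str k 1)
  /-- the generic fibre, with the origin given by the section, is an elliptic curve -/
  elliptic : ∃ W : WeierstrassCurve (RatFunc k), W.IsElliptic ∧ IsGenericFibre ρ σ section_eq W
  /-- relative minimality: every birational morphism over the base onto a smooth proper surface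
  is an isomorphism -/
  minimal : ∀ (S' : Scheme.{u}) (ρ' : S' ⟶ PSpace k 1) (f : S ⟶ S'), f ≫ ρ' = ρ →
    SmoothOfRelativeDimension 2 (ρ' ≫ PSpace.str k 1) → IsProper (ρ' ≫ PSpace.str k 1) →
    IsBirationalMorphism f → IsIso f
  /-- there is a fibre that is not (geometrically) smooth -/
  singular : ∃ p : PSpace k 1, ¬ Smooth (ρ.fiberToSpecResidueField p)

namespace EllipticSurface

variable (E : EllipticSurface k)

/-- `W` is a Weierstrass equation of the generic fibre. -/
def HasWeierstrassModel (W : WeierstrassCurve (RatFunc k)) : Prop :=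
  IsGenericFibre E.ρ E.σ E.section_eq W

/-- `E` is rational: its base change to an algebraic closure of `k` is birational to the
projective plane. -/
def IsRational : Prop :=
  Scheme.BirationalOver
    (pullback.snd (E.ρ ≫ PSpace.str k 1)
      (Spec.map (CommRingCat.ofHom (algebraMap k (AlgebraicClosure k)))))
    (PSpace.str (AlgebraicClosure k) 2)

/-- `E` is isotrivial: the `j`-invariant of the generic fibre, computed from any of its
Weierstrass equations, lies in `k`. -/
def IsIsotrivial : Prop :=
  ∀ (W : WeierstrassCurve (RatFunc k)) [W.IsElliptic], E.HasWeierstrassModel W →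
    ∃ c : k, W.j = algebraMap k (RatFunc k) c

end EllipticSurface

/-- The Weierstrass curve `Y² = X³ + a(T) X + b(T)` over `k(T)`. -/
def shortWeierstrass (a b : Polynomial k) : WeierstrassCurve (RatFunc k) where
  a₁ := 0
  a₂ := 0
  a₃ := 0
  a₄ := algebraMap (Polynomial k) (RatFunc k) a
  a₆ := algebraMap (Polynomial k) (RatFunc k) b

/-- `Y² = X³ + a(T) X + b(T)` is a Weierstrass equation of the generic fibre of `E` of the kind
from which the sextic hypersurface associated to `E` is formed: `deg a ≤ 4`, `deg b ≤ 6` and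
`4a³ + 27b²` is not constant. -/
structure EllipticSurface.IsSexticModel (E : EllipticSurface k) (a b : Polynomial k) : Prop where
  degree_a : a.natDegree ≤ 4
  degree_b : b.natDegree ≤ 6
  disc : ∀ c : k, 4 * a ^ 3 + 27 * b ^ 2 ≠ Polynomial.C c
  model : E.HasWeierstrassModel (shortWeierstrass a b)

/-! ### Sextic hypersurfaces in `ℙ(1,1,2,3)` -/

lemma isWeightedHomogeneous_rename {d : ℕ} {P : MvPolynomial (Fin 2) k} (hP : P.IsHomogeneous d) :
    MvPolynomial.IsWeightedHomogeneous ![1, 1, 2, 3]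
      (MvPolynomial.rename (Fin.castLE (by norm_num : 2 ≤ 4)) P) d := by
  rw [MvPolynomial.IsHomogeneous] at hP
  intro m hm
  obtain ⟨s, rfl, hs⟩ := MvPolynomial.coeff_rename_ne_zero _ _ _ hm
  have := hP hs
  rw [← this]
  rw [Finsupp.weight_apply, Finsupp.sum_mapDomain_index (by simp) (by simp [add_mul]),
    Finsupp.weight_apply]
  refine Finset.sum_congr rfl fun i _ => ?_
  fin_cases i <;> rfl

/-- The sextic form `w² - (z³ + G(x,y) z + F(x,y))` in the variables `x, y, z, w`
of weights `1, 1, 2, 3`. -/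
def sexticForm (G F : MvPolynomial (Fin 2) k) (hG : G.IsHomogeneous 4) (hF : F.IsHomogeneous 6) :
    WForm k ![1, 1, 2, 3] 6 where
  poly := MvPolynomial.X 3 ^ 2 - (MvPolynomial.X 2 ^ 3
    + MvPolynomial.rename (Fin.castLE (by norm_num : 2 ≤ 4)) G * MvPolynomial.X 2
    + MvPolynomial.rename (Fin.castLE (by norm_num : 2 ≤ 4)) F)
  homog := by
    have hX := MvPolynomial.isWeightedHomogeneous_X k ![1, 1, 2, 3]
    have h3 := (hX 3).pow 2
    have h2 := (hX 2).pow 3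
    exact Submodule.sub_mem (MvPolynomial.weightedHomogeneousSubmodule k ![1, 1, 2, 3] 6) h3
      ((h2.add ((isWeightedHomogeneous_rename hG).mul (hX 2))).add
        (isWeightedHomogeneous_rename hF))

/-- The sextic hypersurface `w² = z³ + G(x,y) z + F(x,y)` with `G(x,y) = y⁴ a(x/y)` and
`F(x,y) = y⁶ b(x/y)`. -/
def associatedSextic (a b : Polynomial k) : WForm k ![1, 1, 2, 3] 6 :=
  sexticForm (a.homogenize 4) (b.homogenize 6) (Polynomial.isHomogeneous_homogenize a)
    (Polynomial.isHomogeneous_homogenize b)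

/-- The sextic hypersurface `w² = z³ + F(x,y)`. -/
def twistSextic (F : MvPolynomial (Fin 2) k) (hF : F.IsHomogeneous 6) : WForm k ![1, 1, 2, 3] 6 :=
  sexticForm 0 F (MvPolynomial.isHomogeneous_zero _ _ _) hF

end

end RatEllSurf

end

/-!
A constant `j`-invariant makes `a³` and `b²` proportional up to constants, so if `a ≠ 0`, every
prime factor `g` of the form `G = y⁴ a(x/y)` has its square dividing `F = y⁶ b(x/y)`. Then the
equation `f = w² - (z³ + G z + F)` lies in the square of the prime ideal `P = (g, z, w)`. That is
impossible on a smooth hypersurface: by infinitesimal lifting on the affine chart `x_j ≠ 0` of a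
variable of weight `1` outside `P`, a point of the cone with values in a nilpotent thickening, on
which `f` vanishes only modulo the nilpotents, can be moved to an actual zero of `f`; but if
`f ∈ P²`, such a move does not change `f` to first order, and Nakayama's lemma gives `f = 0` in the
local ring at `P`. So `a = 0`, and the same argument with `G = 0` shows that no `g²` divides `F`.
-/

namespace RatEllSurf

theorem not_isSquare_of_squarefree {M : Type*} [Monoid M] {x : M} (hx : Squarefree x)
    (hunit : ¬ IsUnit x) : ¬ IsSquare x := by
  rintro ⟨d, rfl⟩
  have d_unit := hx d dvd_rfl
  exact hunit (d_unit.mul d_unit)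

theorem map_sub_map_mem_mul_of_mem_sq {A S : Type*} [CommRing A] [CommRing S] {φ ψ : A →+* S}
    {P : Ideal A} {I J : Ideal S} (hI : ∀ a, φ a - ψ a ∈ I) (hφ : P ≤ J.comap φ)
    (hψ : P ≤ J.comap ψ) {a : A} (ha : a ∈ P ^ 2) : φ a - ψ a ∈ J * I := by
  rw [pow_two] at ha
  refine Submodule.mul_induction_on ha (fun x hx y hy => ?_) fun x y hx hy => ?_
  · have leibniz : φ (x * y) - ψ (x * y) = φ x * (φ y - ψ y) + ψ y * (φ x - ψ x) := by
      rw [map_mul, map_mul]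
      ring
    rw [leibniz]
    exact add_mem (Ideal.mul_mem_mul (hφ hx) (hI y)) (Ideal.mul_mem_mul (hψ hy) (hI x))
  · rw [map_add, map_add, add_sub_add_comm]
    exact add_mem hx hy

theorem aeval_sub_aeval_mem {R S ι : Type*} [CommSemiring R] [CommRing S] [Algebra R S]
    {I : Ideal S} {v v' : ι → S} (h : ∀ i, v i - v' i ∈ I) (p : MvPolynomial ι R) :
    MvPolynomial.aeval v p - MvPolynomial.aeval v' p ∈ I := by
  rw [← Ideal.Quotient.eq, ← Ideal.Quotient.mkₐ_eq_mk R, MvPolynomial.comp_aeval_apply,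
    MvPolynomial.comp_aeval_apply]
  congr! 2 with
  exact funext fun i => Ideal.Quotient.eq.mpr (h i)

theorem eq_zero_of_mem_maximalIdeal_mul_span_singleton {R : Type*} [CommRing R]
    [IsLocalRing R] {x : R} (hx : x ∈ IsLocalRing.maximalIdeal R * Ideal.span {x}) : x = 0 := by
  have : Ideal.span {x} = ⊥ := Submodule.eq_bot_of_le_smul_of_le_jacobson_bot
    (IsLocalRing.maximalIdeal R) _ (Submodule.fg_span_singleton x)
    ((Ideal.span_singleton_le_iff_mem _).mpr hx) (IsLocalRing.maximalIdeal_le_jacobson _)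
  exact Ideal.span_singleton_eq_bot.mp this

theorem exists_not_dvd_X {R ι : Type*} [CommRing R] [IsDomain R] [Nontrivial ι]
    {g : MvPolynomial ι R} (hg : Prime g) : ∃ i, ¬ g ∣ MvPolynomial.X i := by
  by_contra! dvd_X
  obtain ⟨i, j, hij⟩ := exists_pair_ne ι
  have associated : Associated g (MvPolynomial.X i) :=
    hg.associated_of_dvd MvPolynomial.X_prime (dvd_X i)
  exact hij (MvPolynomial.X_dvd_X.mp (associated.symm.dvd.trans (dvd_X j)))

theorem not_isUnit_of_isHomogeneous {R ι : Type*} [CommSemiring R] [Nontrivial R]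
    {p : MvPolynomial ι R} {d : ℕ} (hp : p.IsHomogeneous d) (hd : d ≠ 0) : ¬ IsUnit p := by
  intro unit
  have coeff_unit := unit.map (MvPolynomial.constantCoeff (R := R) (σ := ι))
  rw [MvPolynomial.constantCoeff_eq, hp.coeff_eq_zero (by simpa using hd.symm)] at coeff_unit
  exact not_isUnit_zero coeff_unit

theorem aeval_pow_mul_of_isWeightedHomogeneous {R S ι : Type*} [CommSemiring R] [CommSemiring S]
    [Algebra R S] {w : ι → ℕ} {d : ℕ} {p : MvPolynomial ι R}
    (hp : MvPolynomial.IsWeightedHomogeneous w p d) (s : S) (v : ι → S) :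
    MvPolynomial.aeval (fun i => s ^ w i * v i) p = s ^ d * MvPolynomial.aeval v p := by
  simp only [MvPolynomial.aeval_def, MvPolynomial.eval₂_eq, Finset.mul_sum]
  refine Finset.sum_congr rfl fun m hm => ?_
  have weight_m : ∑ i ∈ m.support, w i * m i = d := by
    rw [← hp (MvPolynomial.mem_support_iff.mp hm), Finsupp.weight_apply, Finsupp.sum]
    simp only [smul_eq_mul, mul_comm]
  simp only [mul_pow, Finset.prod_mul_distrib, ← pow_mul, Finset.prod_pow_eq_pow_sum, weight_m]
  ring

theorem homogenize_pow {R : Type*} [CommSemiring R] {p : Polynomial R} {m : ℕ}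
    (hp : p.natDegree ≤ m) (n : ℕ) : (p ^ n).homogenize (n * m) = p.homogenize m ^ n := by
  simpa using Polynomial.homogenize_finsetProd (s := Finset.range n) fun _ _ => hp

theorem homogenize_dvd_homogenize {R : Type*} [CommSemiring R] [NoZeroDivisors R]
    {p q : Polynomial R} {n : ℕ} (hpq : p ∣ q) (hq : q.natDegree ≤ n) :
    p.homogenize p.natDegree ∣ q.homogenize n := by
  have homogenize_eq := Polynomial.homogenize_mul q 1 le_rfl
    (Polynomial.natDegree_one.trans_le (Nat.zero_le (n - q.natDegree)))
  rw [mul_one, Nat.add_sub_cancel' hq] at homogenize_eq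
  rw [homogenize_eq]
  exact (Polynomial.homogenize_dvd hpq).mul_right _

theorem squarefree_of_squarefree_homogenize {R : Type*} [CommSemiring R] [NoZeroDivisors R]
    {p : Polynomial R} {n : ℕ} (hp : p.natDegree ≤ n) (hsq : Squarefree (p.homogenize n)) :
    Squarefree p := by
  intro d hd
  have homogenize_sq_dvd := homogenize_dvd_homogenize hd hp
  rw [← pow_two, Polynomial.natDegree_pow, homogenize_pow le_rfl, pow_two] at homogenize_sq_dvd
  rw [← Polynomial.aeval_homogenize_X_one d le_rfl]
  exact (hsq _ homogenize_sq_dvd).map _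

section HomogeneousLocalization

variable {K A : Type*} [CommRing K] [CommRing A] [Algebra K A] (𝒜 : ℕ → Submodule K A)
  [GradedAlgebra 𝒜]

noncomputable instance (M : Submonoid A) : Algebra K (HomogeneousLocalization 𝒜 M) where
  algebraMap := (HomogeneousLocalization.fromZeroRingHom 𝒜 M).comp (algebraMap K (𝒜 0))
  commutes' _ _ := mul_comm _ _
  smul_def' c y := HomogeneousLocalization.val_injective M <| by
    rw [HomogeneousLocalization.val_smul, HomogeneousLocalization.val_mul, Algebra.smul_def]
    rfl

instance (M : Submonoid A) :
    IsScalarTower K (HomogeneousLocalization 𝒜 M) (Localization M) :=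
  ⟨fun c y z => by
    rw [Algebra.smul_def, Algebra.smul_def y, HomogeneousLocalization.algebraMap_apply,
      HomogeneousLocalization.algebraMap_apply, HomogeneousLocalization.val_smul, smul_mul_assoc]⟩

end HomogeneousLocalization

theorem formallySmooth_away {K A : Type u} [Field K] [CommRing A] [Algebra K A]
    (𝒜 : ℕ → Submodule K A) [GradedAlgebra 𝒜] [Smooth (projStr 𝒜)] {x : A} {m : ℕ} (hx : x ∈ 𝒜 m)
    (hm : 0 < m) : Algebra.FormallySmooth K (HomogeneousLocalization.Away 𝒜 x) := by
  have chart_smooth : Smooth (Proj.awayι 𝒜 x hx hm ≫ projStr 𝒜) := inferInstance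
  rw [projStr, Proj.awayι_toSpecZero_assoc, ← Spec.map_comp,
    HasRingHomProperty.Spec_iff (P := @Smooth)] at chart_smooth
  have algebraMap_smooth : (algebraMap K (HomogeneousLocalization.Away 𝒜 x)).Smooth := chart_smooth
  exact RingHom.formallySmooth_algebraMap.mp algebraMap_smooth.formallySmooth

namespace WForm

variable {K : Type u} [Field K] {n : ℕ} {w : Fin n → ℕ} {d : ℕ} (f : WForm K w d)

/-- The class of the `j`-th variable in the homogeneous coordinate ring. -/
noncomputable def coord (j : Fin n) : f.CoordRing :=
  Ideal.Quotient.mkₐ K (Ideal.span {f.poly}) (MvPolynomial.X j)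

theorem coord_mem (j : Fin n) : f.coord j ∈ f.grading (w j) :=
  f.mk_mem_grading (MvPolynomial.isWeightedHomogeneous_X K w j)

theorem aeval_coord : MvPolynomial.aeval f.coord f.poly = 0 := by
  have aeval_eq_mk : MvPolynomial.aeval f.coord = Ideal.Quotient.mkₐ K (Ideal.span {f.poly}) :=
    MvPolynomial.algHom_ext fun j => MvPolynomial.aeval_X _ j
  rw [aeval_eq_mk]
  exact Ideal.Quotient.eq_zero_iff_mem.mpr (Ideal.mem_span_singleton_self _)

/-- The affine coordinate ring of the chart of the hypersurface where the `j`-th coordinate does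
not vanish. -/
abbrev Chart (j : Fin n) : Type u := HomogeneousLocalization.Away f.grading (f.coord j)

variable {j : Fin n} (hj : w j = 1)

/-- The affine coordinate `x_m / x_j ^ w_m` on the chart `x_j ≠ 0`, where `x_j` has weight `1`. -/
noncomputable def chartCoord (m : Fin n) : f.Chart j :=
  HomogeneousLocalization.Away.mk f.grading (f.coord_mem j) (w m) (f.coord m)
    (by simpa [hj] using f.coord_mem m)

theorem algebraMap_coord_pow_mul_chartCoord (m : Fin n) :
    algebraMap f.CoordRing (Localization.Away (f.coord j)) (f.coord j) ^ w m *
      algebraMap (f.Chart j) (Localization.Away (f.coord j)) (f.chartCoord hj m) =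
      algebraMap f.CoordRing (Localization.Away (f.coord j)) (f.coord m) := by
  rw [HomogeneousLocalization.algebraMap_apply, chartCoord,
    HomogeneousLocalization.Away.val_mk, Localization.mk_eq_mk', ← map_pow]
  exact IsLocalization.mk'_spec' _ (f.coord m)
    (⟨f.coord j ^ w m, w m, rfl⟩ : Submonoid.powers (f.coord j))

theorem aeval_chartCoord : MvPolynomial.aeval (f.chartCoord hj) f.poly = 0 := by
  let x : Localization.Away (f.coord j) := algebraMap f.CoordRing _ (f.coord j)
  have x_unit : IsUnit x := IsLocalization.Away.algebraMap_isUnit _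
  apply HomogeneousLocalization.val_injective
  rw [HomogeneousLocalization.val_zero, ← HomogeneousLocalization.algebraMap_apply,
    ← MvPolynomial.aeval_algebraMap_apply, ← (x_unit.pow d).mul_right_eq_zero,
    ← aeval_pow_mul_of_isWeightedHomogeneous f.homog]
  simp only [x, Function.comp_apply, algebraMap_coord_pow_mul_chartCoord]
  exact (MvPolynomial.aeval_algebraMap_apply _ f.coord f.poly).trans (by rw [aeval_coord, map_zero])

theorem aeval_pow_mul_map_chartCoord {R : Type*} [CommRing R] [Algebra K R]
    (φ : f.Chart j →ₐ[K] R) (s : R) :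
    MvPolynomial.aeval (fun m => s ^ w m * φ (f.chartCoord hj m)) f.poly = 0 := by
  rw [aeval_pow_mul_of_isWeightedHomogeneous f.homog, ← MvPolynomial.comp_aeval_apply,
    aeval_chartCoord, map_zero, mul_zero]

theorem exists_algHom_chart {R : Type*} [CommRing R] [Algebra K R] {v : Fin n → R}
    (hv : MvPolynomial.aeval v f.poly = 0) (hvj : IsUnit (v j)) :
    ∃ φ : f.Chart j →ₐ[K] R, ∀ m, v j ^ w m * φ (f.chartCoord hj m) = v m := by
  have vanish : ∀ p ∈ Ideal.span {f.poly}, MvPolynomial.aeval v p = 0 := by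
    intro p hp
    obtain ⟨q, rfl⟩ := Ideal.mem_span_singleton.mp hp
    rw [map_mul, hv, zero_mul]
  let ev : f.CoordRing →ₐ[K] R := Ideal.Quotient.liftₐ _ (MvPolynomial.aeval v) vanish
  have ev_coord : ∀ m, ev (f.coord m) = v m := fun m => MvPolynomial.aeval_X v m
  have ev_unit : ∀ y : Submonoid.powers (f.coord j), IsUnit (ev y) := by
    rintro ⟨_, i, rfl⟩
    simpa only [map_pow, ev_coord] using hvj.pow i
  let evLoc : Localization.Away (f.coord j) →ₐ[K] R := IsLocalization.liftAlgHom ev_unit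
  have evLoc_algebraMap : ∀ a, evLoc (algebraMap _ _ a) = ev a := IsLocalization.lift_eq _
  refine ⟨evLoc.comp (IsScalarTower.toAlgHom K (f.Chart j) _), fun m => ?_⟩
  rw [← ev_coord, ← ev_coord, ← evLoc_algebraMap, ← evLoc_algebraMap,
    ← f.algebraMap_coord_pow_mul_chartCoord hj m, map_mul, map_pow]
  rfl

include hj in
theorem exists_aeval_eq_zero_of_smooth [Smooth f.str] {S : Type u} [CommRing S] [Algebra K S]
    {I : Ideal S} (hI : IsNilpotent I) {v : Fin n → S} (hvj : IsUnit (v j))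
    (hv : MvPolynomial.aeval v f.poly ∈ I) :
    ∃ v' : Fin n → S, (∀ m, v m - v' m ∈ I) ∧ MvPolynomial.aeval v' f.poly = 0 := by
  have : Algebra.FormallySmooth K (f.Chart j) :=
    formallySmooth_away f.grading (f.coord_mem j) (hj ▸ one_pos)
  have reduction_zero : MvPolynomial.aeval (fun m => Ideal.Quotient.mkₐ K I (v m)) f.poly = 0 := by
    rw [← MvPolynomial.comp_aeval_apply]
    exact Ideal.Quotient.eq_zero_iff_mem.mpr hv
  obtain ⟨φ, hφ⟩ := f.exists_algHom_chart hj reduction_zero (hvj.map _)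
  obtain ⟨ψ, rfl⟩ := Algebra.FormallySmooth.exists_lift I hI φ
  refine ⟨fun m => v j ^ w m * ψ (f.chartCoord hj m), fun m => ?_,
    f.aeval_pow_mul_map_chartCoord hj ψ (v j)⟩
  rw [← Ideal.Quotient.eq]
  simpa using (hφ m).symm

include hj in
theorem aeval_eq_zero_of_mem_sq_of_smooth [Smooth f.str] {R : Type u} [CommRing R] [IsLocalRing R]
    [Algebra K R] {v : Fin n → R} (hvj : IsUnit (v j))
    (hf : f.poly ∈ ((IsLocalRing.maximalIdeal R).comap (MvPolynomial.aeval (R := K) v)) ^ 2) :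
    MvPolynomial.aeval v f.poly = 0 := by
  let 𝔪 := IsLocalRing.maximalIdeal R
  let x := MvPolynomial.aeval v f.poly
  have x_mem : x ∈ 𝔪 := Ideal.mem_comap.mp (Ideal.pow_le_self (n := 2) two_ne_zero hf)
  -- Modulo `𝔪 * (x)` the point `v` moves by multiples of `x` to a zero of `f`; as the derivatives
  -- of `f` at `v` lie in `𝔪`, the move does not change the value `x`, which is therefore zero.
  let S := R ⧸ 𝔪 * Ideal.span {x}
  let π : R →ₐ[K] S := Ideal.Quotient.mkₐ K _
  let I : Ideal S := (Ideal.span {x}).map π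
  let J : Ideal S := 𝔪.map π
  have mul_eq_bot : J * I = ⊥ := by
    rw [← Ideal.map_mul]
    exact Ideal.map_quotient_self _
  have I_le_J : I ≤ J := Ideal.map_mono ((Ideal.span_singleton_le_iff_mem _).mpr x_mem)
  have I_nilpotent : IsNilpotent I :=
    ⟨2, by rw [pow_two]; exact eq_bot_mono (Ideal.mul_mono_left I_le_J) mul_eq_bot⟩
  have aeval_π : ∀ p, MvPolynomial.aeval (π ∘ v) p = π (MvPolynomial.aeval v p) :=
    fun p => (MvPolynomial.comp_aeval_apply v π p).symm
  obtain ⟨v', hv', lift_zero⟩ := f.exists_aeval_eq_zero_of_smooth hj I_nilpotent (hvj.map π)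
    (aeval_π f.poly ▸ Ideal.mem_map_of_mem π (Ideal.mem_span_singleton_self x))
  have diff_mem : π x - MvPolynomial.aeval v' f.poly ∈ J * I := by
    have P_le : 𝔪.comap (MvPolynomial.aeval (R := K) v) ≤
        J.comap ((π : R →+* S).comp (MvPolynomial.aeval (R := K) v : _ →+* R)) := fun p hp =>
      Ideal.mem_map_of_mem π hp
    have sub_mem_I : ∀ p, π (MvPolynomial.aeval v p) - MvPolynomial.aeval v' p ∈ I := fun p =>
      aeval_π p ▸ aeval_sub_aeval_mem hv' p
    refine map_sub_map_mem_mul_of_mem_sq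
      (ψ := (MvPolynomial.aeval (R := K) v' : _ →+* S)) sub_mem_I P_le (fun p hp => ?_) hf
    exact (Submodule.sub_mem_iff_right J (P_le hp)).mp (I_le_J (sub_mem_I p))
  rw [lift_zero, sub_zero, mul_eq_bot] at diff_mem
  exact eq_zero_of_mem_maximalIdeal_mul_span_singleton (Ideal.Quotient.eq_zero_iff_mem.mp diff_mem)

include hj in
theorem poly_notMem_sq_of_smooth [Smooth f.str] (hf : f.poly ≠ 0)
    {P : Ideal (MvPolynomial (Fin n) K)} [P.IsPrime] (hP : MvPolynomial.X j ∉ P) :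
    f.poly ∉ P ^ 2 := by
  intro poly_mem
  let v (m : Fin n) : Localization.AtPrime P :=
    algebraMap (MvPolynomial (Fin n) K) _ (MvPolynomial.X m)
  have aeval_v : ∀ p, MvPolynomial.aeval (R := K) v p = algebraMap _ (Localization.AtPrime P) p :=
    fun p => (MvPolynomial.aeval_algebraMap_apply _ MvPolynomial.X p).trans
      (by rw [MvPolynomial.aeval_X_left_apply])
  have X_unit : IsUnit (v j) := IsLocalization.map_units _ (⟨_, hP⟩ : P.primeCompl)
  have comap_eq : (IsLocalRing.maximalIdeal (Localization.AtPrime P)).comap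
      (MvPolynomial.aeval (R := K) v) = P := by
    ext p
    rw [Ideal.mem_comap, aeval_v]
    exact IsLocalization.AtPrime.to_map_mem_maximal_iff _ P p
  have poly_zero := f.aeval_eq_zero_of_mem_sq_of_smooth hj X_unit (comap_eq.symm ▸ poly_mem)
  rw [aeval_v] at poly_zero
  exact hf ((IsLocalization.to_map_eq_zero_iff _ P.primeCompl_le_nonZeroDivisors).mp poly_zero)

end WForm

section Sextic

variable {k : Type u} [Field k] {G F : MvPolynomial (Fin 2) k} (hG : G.IsHomogeneous 4)
  (hF : F.IsHomogeneous 6)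

/-- Restriction of a polynomial in `x, y, z, w` to the plane `z = w = 0`. -/
noncomputable def planeRestriction : MvPolynomial (Fin 4) k →ₐ[k] MvPolynomial (Fin 2) k :=
  MvPolynomial.aeval ![MvPolynomial.X 0, MvPolynomial.X 1, 0, 0]

theorem planeRestriction_rename (p : MvPolynomial (Fin 2) k) :
    planeRestriction (MvPolynomial.rename (Fin.castLE (by norm_num : 2 ≤ 4)) p) = p := by
  rw [planeRestriction, MvPolynomial.aeval_rename]
  convert MvPolynomial.aeval_X_left_apply p
  ext1 i
  fin_cases i <;> rfl

theorem sexticForm_poly_ne_zero : (sexticForm G F hG hF).poly ≠ 0 := by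
  intro poly_zero
  have eval_eq (t : k) : t ^ 2 = MvPolynomial.eval ![0, 0] F := by
    have rename_eval : ![0, 0, 0, t] ∘ Fin.castLE (by norm_num : 2 ≤ 4) = ![0, 0] := by
      ext i
      fin_cases i <;> rfl
    simpa [sexticForm, MvPolynomial.eval_rename, rename_eval, sub_eq_zero] using
      congrArg (MvPolynomial.eval ![0, 0, 0, t]) poly_zero
  exact zero_ne_one (α := k) (by simpa using (eval_eq 0).trans (eval_eq 1).symm)

theorem not_smooth_sexticForm {g : MvPolynomial (Fin 2) k} (hg : Prime g) (hgG : g ∣ G)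
    (hgF : g ^ 2 ∣ F) : ¬ Smooth (sexticForm G F hG hF).str := by
  intro smooth
  have span_prime : (Ideal.span {g}).IsPrime :=
    (Ideal.span_singleton_prime hg.ne_zero).mpr hg
  let P : Ideal (MvPolynomial (Fin 4) k) := (Ideal.span {g}).comap planeRestriction
  have mem_P : ∀ p, p ∈ P ↔ g ∣ planeRestriction p := fun p => Ideal.mem_span_singleton
  have rename_mem : ∀ p, g ∣ p →
      MvPolynomial.rename (Fin.castLE (by norm_num : 2 ≤ 4)) p ∈ P := fun p hp => by
    rwa [mem_P, planeRestriction_rename]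
  have z_mem : MvPolynomial.X 2 ∈ P := by simp [mem_P, planeRestriction]
  have w_mem : MvPolynomial.X 3 ∈ P := by simp [mem_P, planeRestriction]
  have F_mem : MvPolynomial.rename (Fin.castLE (by norm_num : 2 ≤ 4)) F ∈ P ^ 2 := by
    obtain ⟨q, rfl⟩ := hgF
    rw [map_mul, map_pow]
    exact Ideal.mul_mem_right _ _ (Ideal.pow_mem_pow (rename_mem g dvd_rfl) 2)
  have poly_mem : (sexticForm G F hG hF).poly ∈ P ^ 2 :=
    sub_mem (Ideal.pow_mem_pow w_mem 2) (add_mem (add_mem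
      (Ideal.pow_le_pow_right (Nat.le_succ 2) (Ideal.pow_mem_pow z_mem 3))
      (pow_two P ▸ Ideal.mul_mem_mul (rename_mem G hgG) z_mem)) F_mem)
  obtain ⟨i, hi⟩ := exists_not_dvd_X hg
  have X_notMem : MvPolynomial.X (Fin.castLE (by norm_num : 2 ≤ 4) i) ∉ P := by
    rwa [mem_P, ← MvPolynomial.rename_X, planeRestriction_rename]
  have weight_one : (![1, 1, 2, 3] : Fin 4 → ℕ) (Fin.castLE (by norm_num : 2 ≤ 4) i) = 1 := by
    fin_cases i <;> rfl
  exact (sexticForm G F hG hF).poly_notMem_sq_of_smooth weight_one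
    (sexticForm_poly_ne_zero hG hF) X_notMem poly_mem

theorem eq_zero_of_smooth_sexticForm (hGF : G ^ 3 ∣ F ^ 2)
    (hX : Smooth (sexticForm G F hG hF).str) : G = 0 := by
  by_contra G_ne_zero
  obtain ⟨g, g_irreducible, hgG⟩ :=
    WfDvdMonoid.exists_irreducible_factor (not_isUnit_of_isHomogeneous hG four_ne_zero) G_ne_zero
  have g_prime : Prime g := g_irreducible.prime
  refine not_smooth_sexticForm hG hF g_prime hgG ?_ hX
  by_contra hgF
  have cube_dvd : g ^ 3 ∣ 1 ^ 3 * F ^ 2 := by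
    rw [one_pow, one_mul]
    exact (pow_dvd_pow_of_dvd hgG 3).trans hGF
  exact g_prime.not_dvd_one
    (g_prime.dvd_of_pow_dvd_pow_mul_pow_of_square_not_dvd (n := 2) cube_dvd hgF)

theorem squarefree_of_smooth_twistSextic (hX : Smooth (twistSextic F hF).str) : Squarefree F := by
  refine (squarefree_iff_irreducible_sq_not_dvd_of_exists_irreducible
    ⟨MvPolynomial.X 0, MvPolynomial.X_prime.irreducible⟩).mpr fun g hg hgF => ?_
  exact not_smooth_sexticForm _ hF hg.prime (dvd_zero g) (pow_two g ▸ hgF) hX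

end Sextic

section Weierstrass

variable {k : Type u} [Field k] {a b : Polynomial k}

instance : (shortWeierstrass a b).IsShortNF := ⟨rfl, rfl, rfl⟩

theorem shortWeierstrass_disc :
    4 * (shortWeierstrass a b).a₄ ^ 3 + 27 * (shortWeierstrass a b).a₆ ^ 2 =
      algebraMap (Polynomial k) (RatFunc k) (4 * a ^ 3 + 27 * b ^ 2) := by
  simp only [shortWeierstrass, map_add, map_mul, map_pow, map_ofNat]

theorem isElliptic_shortWeierstrass [NeZero (2 : k)] (hab : 4 * a ^ 3 + 27 * b ^ 2 ≠ 0) :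
    (shortWeierstrass a b).IsElliptic := by
  have sixteen_ne_zero : (16 : RatFunc k) ≠ 0 := by
    rw [← map_ofNat (algebraMap k (RatFunc k)), map_ne_zero, show (16 : k) = 2 ^ 4 by norm_num]
    exact pow_ne_zero 4 two_ne_zero
  refine ⟨isUnit_iff_ne_zero.mpr ?_⟩
  rw [WeierstrassCurve.Δ_of_isShortNF, shortWeierstrass_disc]
  exact mul_ne_zero (neg_ne_zero.mpr sixteen_ne_zero)
    ((map_ne_zero_iff _ (RatFunc.algebraMap_injective k)).mpr hab)

theorem mul_cube_eq_of_j_eq [(shortWeierstrass a b).IsElliptic] {c : k}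
    (hc : (shortWeierstrass a b).j = algebraMap k (RatFunc k) c) :
    6912 * a ^ 3 = Polynomial.C c * (4 * a ^ 3 + 27 * b ^ 2) := by
  have disc_ne_zero := (shortWeierstrass a b).isUnit_Δ.ne_zero
  rw [WeierstrassCurve.Δ_of_isShortNF] at disc_ne_zero
  rw [WeierstrassCurve.j_of_isShortNF, div_eq_iff (right_ne_zero_of_mul disc_ne_zero),
    shortWeierstrass_disc, IsScalarTower.algebraMap_apply k (Polynomial k) (RatFunc k),
    Polynomial.algebraMap_eq, ← map_mul] at hc
  apply RatFunc.algebraMap_injective k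
  rw [← hc, map_mul, map_pow, map_ofNat, shortWeierstrass]

theorem eq_zero_or_sq_eq_C_mul_cube [NeZero (2 : k)] [NeZero (3 : k)] {c : k}
    (hc : 6912 * a ^ 3 = Polynomial.C c * (4 * a ^ 3 + 27 * b ^ 2)) :
    a = 0 ∨ ∃ r : k, b ^ 2 = Polynomial.C r * a ^ 3 := by
  rcases eq_or_ne c 0 with rfl | c_ne_zero
  · left
    have coeff_ne_zero : (6912 : k) ≠ 0 := by
      rw [show (6912 : k) = 2 ^ 8 * 3 ^ 3 by norm_num]
      exact mul_ne_zero (pow_ne_zero 8 two_ne_zero) (pow_ne_zero 3 three_ne_zero)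
    have := Polynomial.C_ne_zero.mpr coeff_ne_zero
    rw [map_ofNat] at this
    simpa [this] using hc
  · right
    have coeff_ne_zero : 27 * c ≠ 0 := by
      rw [show (27 : k) = 3 ^ 3 by norm_num]
      exact mul_ne_zero (pow_ne_zero 3 three_ne_zero) c_ne_zero
    refine ⟨(27 * c)⁻¹ * (6912 - 4 * c), ?_⟩
    apply mul_left_cancel₀ (Polynomial.C_ne_zero.mpr coeff_ne_zero)
    rw [← mul_assoc, ← map_mul, mul_inv_cancel_left₀ coeff_ne_zero]
    simp only [map_sub, map_mul, map_ofNat]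
    linear_combination -hc

end Weierstrass

namespace EllipticSurface.IsSexticModel

variable {k : Type u} [Field k] {E : EllipticSurface k} {a b : Polynomial k}

theorem eq_zero_of_smooth [NeZero (2 : k)] [NeZero (3 : k)] (hab : E.IsSexticModel a b)
    (hiso : E.IsIsotrivial) (hX : Smooth (associatedSextic a b).str) : a = 0 := by
  have : (shortWeierstrass a b).IsElliptic :=
    isElliptic_shortWeierstrass (by simpa using hab.disc 0)
  obtain ⟨c, hc⟩ := hiso _ hab.model
  obtain a_zero | ⟨r, hr⟩ := eq_zero_or_sq_eq_C_mul_cube (mul_cube_eq_of_j_eq hc)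
  · exact a_zero
  have homogenize_cube_dvd : a.homogenize 4 ^ 3 ∣ b.homogenize 6 ^ 2 := by
    rw [← homogenize_pow hab.degree_a, ← homogenize_pow hab.degree_b, hr,
      Polynomial.homogenize_C_mul]
    exact dvd_mul_left _ _
  exact (Polynomial.homogenize_eq_zero_iff hab.degree_a).mp
    (eq_zero_of_smooth_sexticForm _ _ homogenize_cube_dvd hX)

theorem one_le_natDegree (hab : E.IsSexticModel 0 b) : 1 ≤ b.natDegree := by
  by_contra! degree_lt
  obtain ⟨r, rfl⟩ := Polynomial.natDegree_eq_zero.mp (Nat.lt_one_iff.mp degree_lt)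
  exact hab.disc (27 * r ^ 2) (by rw [map_mul, map_pow, map_ofNat]; ring)

end EllipticSurface.IsSexticModel

theorem associatedSextic_zero_left {k : Type u} [Field k] (b : Polynomial k) :
    associatedSextic 0 b =
      twistSextic (b.homogenize 6) (Polynomial.isHomogeneous_homogenize b) := by
  simp only [associatedSextic, twistSextic, Polynomial.homogenize_zero]

end RatEllSurf

theorem mainTheorem11_general {k : Type u} [Field k] [NeZero (2 : k)] [NeZero (3 : k)]
    (E : RatEllSurf.EllipticSurface k) (hiso : E.IsIsotrivial)
    (a b : Polynomial k) (hab : E.IsSexticModel a b)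
    (hX : Smooth (RatEllSurf.associatedSextic a b).str) :
    ∃ (F : MvPolynomial (Fin 2) k) (hF : F.IsHomogeneous 6),
      Squarefree F ∧
      (∃ e : (RatEllSurf.associatedSextic a b).hypersurface ≅
          (RatEllSurf.twistSextic F hF).hypersurface,
        e.hom ≫ (RatEllSurf.twistSextic F hF).str = (RatEllSurf.associatedSextic a b).str) ∧
      ∃ f : Polynomial k, f = MvPolynomial.aeval ![Polynomial.X, 1] F ∧
        Squarefree f ∧ ¬ IsSquare f ∧ 1 ≤ f.natDegree ∧ f.natDegree ≤ 6 ∧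
        E.HasWeierstrassModel (RatEllSurf.shortWeierstrass 0 f) := by
  obtain rfl : a = 0 := hab.eq_zero_of_smooth hiso hX
  rw [RatEllSurf.associatedSextic_zero_left] at hX ⊢
  have F_squarefree := RatEllSurf.squarefree_of_smooth_twistSextic _ hX
  have b_squarefree := RatEllSurf.squarefree_of_squarefree_homogenize hab.degree_b F_squarefree
  have b_not_unit : ¬ IsUnit b := Polynomial.not_isUnit_of_natDegree_pos b hab.one_le_natDegree
  exact ⟨b.homogenize 6, Polynomial.isHomogeneous_homogenize b, F_squarefree,
    ⟨Iso.refl _, Category.id_comp _⟩, b, (Polynomial.aeval_homogenize_X_one b hab.degree_b).symm,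
    b_squarefree, RatEllSurf.not_isSquare_of_squarefree b_squarefree b_not_unit,
    hab.one_le_natDegree, hab.degree_b, hab.model⟩

theorem mainTheorem11 {k : Type u} [Field k] [NumberField k]
    (E : RatEllSurf.EllipticSurface k) (hrat : E.IsRational) (hiso : E.IsIsotrivial)
    (a b : Polynomial k) (hab : E.IsSexticModel a b)
    (hX : Smooth (RatEllSurf.associatedSextic a b).str) :
    ∃ (F : MvPolynomial (Fin 2) k) (hF : F.IsHomogeneous 6),
      Squarefree F ∧
      (∃ e : (RatEllSurf.associatedSextic a b).hypersurface ≅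
          (RatEllSurf.twistSextic F hF).hypersurface,
        e.hom ≫ (RatEllSurf.twistSextic F hF).str = (RatEllSurf.associatedSextic a b).str) ∧
      ∃ f : Polynomial k, f = MvPolynomial.aeval ![Polynomial.X, 1] F ∧
        Squarefree f ∧ ¬ IsSquare f ∧ 1 ≤ f.natDegree ∧ f.natDegree ≤ 6 ∧
        E.HasWeierstrassModel (RatEllSurf.shortWeierstrass 0 f) :=
  mainTheorem11_general E hiso a b hab hX
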